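/- For $n\ge 3$ let $\mathcal D_n=\mathcal D_n(a,b,c,d)$ be the DFA with state set $\{1,\dots,n\}$, alphabet $\Sigma=\{a,b,c,d\}$, initial state $1$, only final state $n$, and transitions given by the following transformations of the states: $a$ acts as the cycle $(1,2,\dots,n-1)$, $b$ as the cycle $(2,\dots,n-1)$ (the identity if $n=3$), $c$ maps $n-1$ to $1$ and fixes all other states, and $d$ maps $n-1$ to $n$ and fixes all other states. Let $L_n=L_n(a,b,c,d)$ be the language accepted by $\mathcal D_n$. For a partial permutation $\pi$ of $\Sigma$ (a bijection between two subsets of $\Sigma$), the dialect $L_n(\pi(a),\pi(b),\pi(c),\pi(d))$ is the language over the alphabet $\pi(\Sigma)$ obtained from $L_n$ by discarding the words that contain a letter on which $\pi$ is undefined and replacing each letter $x$ by $\pi(x)$ in the remaining words; an undefined value is written $-$. Thus $L_n(a,b,-,d)$ and $L_n(b,a,-,d)$ are languages over $\{a,b,d\}$, and in the latter the letters $a$ and $b$ have exchanged their roles. The complexity of a regular language $L$ over an alphabet $\Gamma$ is the number of its distinct left quotients $w^{-1}L=\{x\in\Gamma^*\mid wx\in L\}$, $w\in\Gamma^*$.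 **Theorem (Right Ideals: Boolean Operations).** Let $m,n\ge 3$. Over the alphabet $\{a,b,d\}$: 1. the complexity of $L_m(a,b,-,d)\cap L_n(b,a,-,d)$ is $mn$; 2. the complexity of the symmetric difference $L_m(a,b,-,d)\oplus L_n(b,a,-,d)$ is $mn$; 3. the complexity of $L_m(a,b,-,d)\setminus L_n(b,a,-,d)$ is $mn-(m-1)$; 4. the complexity of $L_m(a,b,-,d)\cup L_n(b,a,-,d)$ is $mn-(m+n-2)$. -/

import Mathlib

/-- The quotient complexity of a language `L` over the alphabet `α`: the number of distinct left
quotients `w⁻¹L = {x | w x ∈ L}` for words `w` over `α` (an element of `ℕ∞`, so that a natural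
number as value includes finiteness, i.e. regularity of `L`). -/
noncomputable def quotientComplexity {α : Type*} (L : Language α) : ℕ∞ :=
  (Set.range L.leftQuotient).encard

/-- The permutational dialect `s_π(L)` of `L` under a partial permutation `π` of the alphabet:
each letter `x` is substituted by `π x` if `π x` is defined, and by the empty language otherwise.
So only those words of `L` contribute on all of whose letters `π` is defined. -/
def dialect {α : Type*} (π : α ≃. α) (L : Language α) : Language α :=
  {w | ∃ v ∈ L, v.map π = w.map some}

/-- A language, considered over the subalphabet `Γ`. -/
def overAlphabet {α : Type*} (Γ : Set α) (L : Language α) : Language Γ :=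
  {w | w.map Subtype.val ∈ L}

/-- The letters occurring in words of a dialect all lie in the range of `π`. -/
theorem exists_of_mem_dialect {α : Type*} {π : α ≃. α} {L : Language α} {w : List α}
    (hw : w ∈ dialect π L) {x : α} (hx : x ∈ w) : ∃ y, π y = some x := by
  obtain ⟨v, -, hv⟩ := hw
  have h : some x ∈ v.map π := by
    rw [hv]
    exact List.mem_map_of_mem hx
  obtain ⟨y, -, hy⟩ := List.mem_map.1 h
  exact ⟨y, hy⟩

/-- The four-letter alphabet `{a, b, c, d}`. -/
inductive Letter : Type
  | a | b | c | d
  deriving DecidableEq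

/-- The subalphabet `{a, b, d}`. -/
def alphabetABD : Set Letter := {Letter.a, Letter.b, Letter.d}

/-- The DFA `D_n(a, b, c, d)`, `n ≥ 3`. Its states are `1, …, n`, where the state `q` is
represented by the element `q - 1` of `Fin n`. The letters induce the transformations
`a : (1, 2, …, n-1)` and `b : (2, …, n-1)` (cycles), `c : (n-1 → 1)` and `d : (n-1 → n)`.
The initial state is `1` and the only final state is `n`. -/
def rightIdealDFA (n : ℕ) (hn : 3 ≤ n) : DFA Letter (Fin n) where
  step q
    | Letter.a =>
        if h : q.val + 2 < n then ⟨q.val + 1, by omega⟩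
        else if q.val + 2 = n then ⟨0, by omega⟩ else q
    | Letter.b =>
        if h : 1 ≤ q.val ∧ q.val + 2 < n then ⟨q.val + 1, by omega⟩
        else if q.val + 2 = n then ⟨1, by omega⟩ else q
    | Letter.c => if q.val + 2 = n then ⟨0, by omega⟩ else q
    | Letter.d => if h : q.val + 2 = n then ⟨q.val + 1, by omega⟩ else q
  start := ⟨0, by omega⟩
  accept := {⟨n - 1, by omega⟩}

/-- The language `L_n(a, b, c, d)` accepted by `D_n(a, b, c, d)`. -/
def rightIdealLang (n : ℕ) (hn : 3 ≤ n) : Language Letter := (rightIdealDFA n hn).accepts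

/-- The partial permutation `a ↦ a, b ↦ b, c ↦ -, d ↦ d` of `{a, b, c, d}`. -/
def permAB : Letter ≃. Letter where
  toFun
    | Letter.a => some Letter.a
    | Letter.b => some Letter.b
    | Letter.c => none
    | Letter.d => some Letter.d
  invFun
    | Letter.a => some Letter.a
    | Letter.b => some Letter.b
    | Letter.c => none
    | Letter.d => some Letter.d
  inv x y := by cases x <;> cases y <;> simp

/-- The partial permutation `a ↦ b, b ↦ a, c ↦ -, d ↦ d` of `{a, b, c, d}`. -/
def permBA : Letter ≃. Letter where
  toFun
    | Letter.a => some Letter.b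
    | Letter.b => some Letter.a
    | Letter.c => none
    | Letter.d => some Letter.d
  invFun
    | Letter.a => some Letter.b
    | Letter.b => some Letter.a
    | Letter.c => none
    | Letter.d => some Letter.d
  inv x y := by cases x <;> cases y <;> simp

/-- The alphabet of the dialects for `permAB` is `{a, b, d}`. -/
theorem range_permAB : {x | ∃ y, permAB y = some x} = alphabetABD := by
  ext x
  constructor
  · rintro ⟨y, hy⟩
    cases y <;> simp [permAB, DFunLike.coe, alphabetABD] at hy ⊢ <;> simp [← hy]
  · rintro (rfl | rfl | rfl)
    exacts [⟨Letter.a, rfl⟩, ⟨Letter.b, rfl⟩, ⟨Letter.d, rfl⟩]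

/-- The alphabet of the dialects for `permBA` is `{a, b, d}`. -/
theorem range_permBA : {x | ∃ y, permBA y = some x} = alphabetABD := by
  ext x
  constructor
  · rintro ⟨y, hy⟩
    cases y <;> simp [permBA, DFunLike.coe, alphabetABD] at hy ⊢ <;> simp [← hy]
  · rintro (rfl | rfl | rfl)
    exacts [⟨Letter.b, rfl⟩, ⟨Letter.a, rfl⟩, ⟨Letter.d, rfl⟩]

/-- The dialect `L_n(a, b, -, d)`, a language over `{a, b, d}`. -/
def langAB (n : ℕ) (hn : 3 ≤ n) : Language alphabetABD :=
  overAlphabet alphabetABD (dialect permAB (rightIdealLang n hn))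

/-- The dialect `L_n(b, a, -, d)`, a language over `{a, b, d}`. -/
def langBA (n : ℕ) (hn : 3 ≤ n) : Language alphabetABD :=
  overAlphabet alphabetABD (dialect permBA (rightIdealLang n hn))

/-- The letter `a` of the alphabet `{a, b, d}`. -/
def letterA : alphabetABD := ⟨Letter.a, by simp [alphabetABD]⟩

/-- The letter `b` of the alphabet `{a, b, d}`. -/
def letterB : alphabetABD := ⟨Letter.b, by simp [alphabetABD]⟩

/-- The letter `d` of the alphabet `{a, b, d}`. -/
def letterD : alphabetABD := ⟨Letter.d, by simp [alphabetABD]⟩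

/-- The involution of `{a, b, d}` exchanging `a` and `b`. -/
def swapAB : alphabetABD → alphabetABD
  | ⟨Letter.a, _⟩ => letterB
  | ⟨Letter.b, _⟩ => letterA
  | ⟨Letter.c, h⟩ => ⟨Letter.c, h⟩
  | ⟨Letter.d, _⟩ => letterD

@[simp] theorem swapAB_letterA : swapAB letterA = letterB := rfl

@[simp] theorem swapAB_letterB : swapAB letterB = letterA := rfl

@[simp] theorem swapAB_letterD : swapAB letterD = letterD := rfl

theorem swapAB_comp_swapAB : swapAB ∘ swapAB = id := by
  funext ⟨x, hx⟩
  cases x <;> rfl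

@[simp] theorem map_swapAB_map_swapAB (w : List alphabetABD) :
    (w.map swapAB).map swapAB = w := by
  rw [List.map_map, swapAB_comp_swapAB, List.map_id]

theorem permAB_eq_some_iff (x : Letter) (y : alphabetABD) :
    permAB x = some y.1 ↔ x = y.1 := by
  obtain ⟨y, rfl | rfl | rfl⟩ := y <;> cases x <;> simp [permAB, DFunLike.coe]

theorem permBA_eq_some_iff (x : Letter) (y : alphabetABD) :
    permBA x = some y.1 ↔ x = (swapAB y).1 := by
  obtain ⟨y, rfl | rfl | rfl⟩ := y <;> cases x <;>
    simp [permBA, DFunLike.coe, swapAB, letterA, letterB, letterD]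

theorem mem_overAlphabet_dialect_iff {π : Letter ≃. Letter} {f : alphabetABD → Letter}
    (hf : ∀ x (y : alphabetABD), π x = some y.1 ↔ x = f y) (L : Language Letter)
    (w : List alphabetABD) :
    w ∈ overAlphabet alphabetABD (dialect π L) ↔ w.map f ∈ L := by
  have key : ∀ (v : List Letter) (w : List alphabetABD),
      v.map π = (w.map Subtype.val).map some ↔ v = w.map f := by
    intro v
    induction v with
    | nil => intro w; cases w <;> simp
    | cons x v ih =>
      intro w
      cases w with
      | nil => simp
      | cons y w =>
        have := ih w
        simp only [List.map_cons, List.cons.injEq, hf, this]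
  change (∃ v ∈ L, v.map π = (w.map Subtype.val).map some) ↔ _
  simp only [key, exists_eq_right]

/-- The DFA `D_n(a, b, -, d)` over the alphabet `{a, b, d}`. -/
def dfaAB (n : ℕ) (hn : 3 ≤ n) : DFA alphabetABD (Fin n) :=
  (rightIdealDFA n hn).comap Subtype.val

/-- The DFA `D_n(b, a, -, d)` over the alphabet `{a, b, d}`. -/
def dfaBA (n : ℕ) (hn : 3 ≤ n) : DFA alphabetABD (Fin n) :=
  (dfaAB n hn).comap swapAB

theorem mem_langAB_iff (n : ℕ) (hn : 3 ≤ n) (w : List alphabetABD) :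
    w ∈ langAB n hn ↔ w ∈ (dfaAB n hn).accepts := by
  rw [langAB, mem_overAlphabet_dialect_iff permAB_eq_some_iff, DFA.mem_accepts, dfaAB,
    DFA.eval_comap]
  rfl

theorem mem_langBA_iff (n : ℕ) (hn : 3 ≤ n) (w : List alphabetABD) :
    w ∈ langBA n hn ↔ w ∈ (dfaBA n hn).accepts := by
  rw [langBA, mem_overAlphabet_dialect_iff permBA_eq_some_iff, DFA.mem_accepts, dfaBA,
    DFA.eval_comap, dfaAB, DFA.eval_comap, List.map_map]
  rfl

/-- The initial state of `D_n`. -/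
def firstState (n : ℕ) (hn : 3 ≤ n) : Fin n := ⟨0, by omega⟩

/-- The only state of `D_n` from which the letter `d` leads to the final state. -/
def penultState (n : ℕ) (hn : 3 ≤ n) : Fin n := ⟨n - 2, by omega⟩

/-- The final state of `D_n`. -/
def lastState (n : ℕ) (hn : 3 ≤ n) : Fin n := ⟨n - 1, by omega⟩

section Component

variable {n : ℕ} (hn : 3 ≤ n)

theorem val_step_letterA (p : Fin n) : ((dfaAB n hn).step p letterA).val =
    if p.val + 2 < n then p.val + 1 else if p.val + 2 = n then 0 else p.val := by
  simp only [dfaAB, DFA.comap_step, letterA, rightIdealDFA]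
  split_ifs <;> rfl

theorem val_step_letterB (p : Fin n) : ((dfaAB n hn).step p letterB).val =
    if 1 ≤ p.val ∧ p.val + 2 < n then p.val + 1 else if p.val + 2 = n then 1 else p.val := by
  simp only [dfaAB, DFA.comap_step, letterB, rightIdealDFA]
  split_ifs <;> rfl

theorem val_step_letterD (p : Fin n) : ((dfaAB n hn).step p letterD).val =
    if p.val + 2 = n then p.val + 1 else p.val := by
  simp only [dfaAB, DFA.comap_step, letterD, rightIdealDFA]
  split_ifs <;> rfl

theorem val_firstState : (firstState n hn).val = 0 := rfl

theorem val_penultState : (penultState n hn).val = n - 2 := rfl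

theorem val_lastState : (lastState n hn).val = n - 1 := rfl

theorem firstState_ne_lastState : firstState n hn ≠ lastState n hn := by
  simp only [firstState, lastState, ne_eq, Fin.mk.injEq]; omega

theorem firstState_ne_penultState : firstState n hn ≠ penultState n hn := by
  simp only [firstState, penultState, ne_eq, Fin.mk.injEq]; omega

theorem penultState_ne_lastState : penultState n hn ≠ lastState n hn := by
  simp only [penultState, lastState, ne_eq, Fin.mk.injEq]; omega

theorem step_letterA_injective : Function.Injective ((dfaAB n hn).step · letterA) := by
  intro p q h
  have := congrArg Fin.val h
  simp only [val_step_letterA] at this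
  ext; split_ifs at this <;> omega

theorem step_letterB_injective : Function.Injective ((dfaAB n hn).step · letterB) := by
  intro p q h
  have := congrArg Fin.val h
  simp only [val_step_letterB] at this
  ext; split_ifs at this <;> omega

theorem step_letterB_firstState :
    (dfaAB n hn).step (firstState n hn) letterB = firstState n hn := by
  have := val_firstState hn
  ext; rw [val_step_letterB]; split_ifs <;> omega

theorem step_letterD_penultState :
    (dfaAB n hn).step (penultState n hn) letterD = lastState n hn := by
  have := val_penultState hn
  have := val_lastState hn
  ext; rw [val_step_letterD]; split_ifs <;> omega

theorem step_letterD_of_ne {p : Fin n} (hp : p ≠ penultState n hn) :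
    (dfaAB n hn).step p letterD = p := by
  have : p.val ≠ n - 2 := fun h => hp (Fin.ext h)
  ext; rw [val_step_letterD]; split_ifs <;> omega

theorem step_lastState (x : alphabetABD) :
    (dfaAB n hn).step (lastState n hn) x = lastState n hn := by
  have := val_lastState hn
  obtain ⟨x, rfl | rfl | rfl⟩ := x <;> ext
  · refine (val_step_letterA hn _).trans ?_; split_ifs <;> omega
  · refine (val_step_letterB hn _).trans ?_; split_ifs <;> omega
  · refine (val_step_letterD hn _).trans ?_; split_ifs <;> omega

@[simp] theorem evalFrom_lastState (w : List alphabetABD) :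
    (dfaAB n hn).evalFrom (lastState n hn) w = lastState n hn := by
  induction w with
  | nil => rfl
  | cons x w ih => rw [DFA.evalFrom_cons, step_lastState, ih]

theorem evalFrom_replicate_injective {x : alphabetABD}
    (hx : Function.Injective ((dfaAB n hn).step · x)) (k : ℕ) :
    Function.Injective ((dfaAB n hn).evalFrom · (List.replicate k x)) := by
  induction k with
  | zero => exact fun _ _ h => h
  | succ k ih => exact fun _ _ h => hx (ih h)

theorem evalFrom_letterA_injective (k : ℕ) :
    Function.Injective ((dfaAB n hn).evalFrom · (List.replicate k letterA)) :=
  evalFrom_replicate_injective hn (step_letterA_injective hn) k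

theorem evalFrom_letterB_injective (k : ℕ) :
    Function.Injective ((dfaAB n hn).evalFrom · (List.replicate k letterB)) :=
  evalFrom_replicate_injective hn (step_letterB_injective hn) k

theorem evalFrom_letterA_ne_lastState (k : ℕ) {p : Fin n} (hp : p ≠ lastState n hn) :
    (dfaAB n hn).evalFrom p (List.replicate k letterA) ≠ lastState n hn := fun h =>
  hp (evalFrom_letterA_injective hn k (h.trans (evalFrom_lastState hn _).symm))

theorem evalFrom_letterB_ne_lastState (k : ℕ) {p : Fin n} (hp : p ≠ lastState n hn) :
    (dfaAB n hn).evalFrom p (List.replicate k letterB) ≠ lastState n hn := fun h =>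
  hp (evalFrom_letterB_injective hn k (h.trans (evalFrom_lastState hn _).symm))

@[simp] theorem evalFrom_letterB_firstState (k : ℕ) :
    (dfaAB n hn).evalFrom (firstState n hn) (List.replicate k letterB) = firstState n hn := by
  induction k with
  | zero => rfl
  | succ k ih => rw [List.replicate_succ, DFA.evalFrom_cons, step_letterB_firstState, ih]

theorem val_evalFrom_letterA (p : Fin n) (k : ℕ) (h : p.val + k + 1 < n) :
    ((dfaAB n hn).evalFrom p (List.replicate k letterA)).val = p.val + k := by
  induction k with
  | zero => rfl
  | succ k ih =>
    rw [List.replicate_succ', DFA.evalFrom_append_singleton, val_step_letterA, ih (by omega)]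
    split_ifs <;> omega

/-- The powers of `a` act transitively on the states that are not final. -/
theorem exists_evalFrom_letterA_eq {p q : Fin n} (hp : p ≠ lastState n hn)
    (hq : q ≠ lastState n hn) :
    ∃ k, (dfaAB n hn).evalFrom p (List.replicate k letterA) = q := by
  have hp' : p.val ≠ n - 1 := fun h => hp (Fin.ext h)
  have hq' : q.val ≠ n - 1 := fun h => hq (Fin.ext h)
  have h0 : (dfaAB n hn).evalFrom p (List.replicate (n - 2 - p.val + 1) letterA) =
      firstState n hn := by
    rw [List.replicate_succ', DFA.evalFrom_append_singleton]
    ext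
    rw [val_step_letterA, val_evalFrom_letterA hn p _ (by omega)]
    simp only [firstState]
    split_ifs <;> omega
  refine ⟨(n - 2 - p.val + 1) + q.val, ?_⟩
  rw [List.replicate_add, DFA.evalFrom_of_append, h0]
  ext
  rw [val_evalFrom_letterA hn _ _ (by simp only [firstState]; omega)]
  simp [firstState]

/-- A word `a ^ k d` that sends exactly one of two distinct states to the final state. -/
theorem exists_evalFrom_letterA_letterD {p p' : Fin n} (hpp : p ≠ p') (hp : p ≠ lastState n hn)
    (hp' : p' ≠ lastState n hn) :
    ∃ k, (dfaAB n hn).evalFrom p (List.replicate k letterA ++ [letterD]) ≠ lastState n hn ∧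
      (dfaAB n hn).evalFrom p' (List.replicate k letterA ++ [letterD]) = lastState n hn := by
  obtain ⟨k, hk⟩ := exists_evalFrom_letterA_eq hn hp' (penultState_ne_lastState hn)
  refine ⟨k, ?_, ?_⟩
  · rw [DFA.evalFrom_append_singleton, step_letterD_of_ne]
    · exact evalFrom_letterA_ne_lastState hn k hp
    · exact fun h => hpp (evalFrom_letterA_injective hn k (h.trans hk.symm))
  · rw [DFA.evalFrom_append_singleton, hk, step_letterD_penultState]

@[simp] theorem evalFrom_letterB_letterD_firstState (k : ℕ) :
    (dfaAB n hn).evalFrom (firstState n hn) (List.replicate k letterB ++ [letterD]) =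
      firstState n hn := by
  rw [DFA.evalFrom_append_singleton, evalFrom_letterB_firstState,
    step_letterD_of_ne hn (firstState_ne_penultState hn)]

theorem step_letterD_injOn {p p' : Fin n} (hp : p ≠ lastState n hn) (hp' : p' ≠ lastState n hn)
    (h : (dfaAB n hn).step p letterD = (dfaAB n hn).step p' letterD) : p = p' := by
  have := congrArg Fin.val h
  have h1 : p.val ≠ n - 1 := fun h => hp (Fin.ext h)
  have h2 : p'.val ≠ n - 1 := fun h => hp' (Fin.ext h)
  simp only [val_step_letterD] at this
  ext; split_ifs at this <;> omega

/-- Two distinct states can be separated by the final state. -/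
theorem exists_evalFrom_eq_lastState_iff_not {p p' : Fin n} (hpp : p ≠ p') :
    ∃ w, ((dfaAB n hn).evalFrom p w = lastState n hn ↔
      ¬ (dfaAB n hn).evalFrom p' w = lastState n hn) := by
  by_cases hp : p = lastState n hn
  · exact ⟨[], by simpa [hp] using fun h => hpp (hp.trans h.symm)⟩
  by_cases hp' : p' = lastState n hn
  · exact ⟨[], by simpa [hp'] using hp⟩
  obtain ⟨k, h, h'⟩ := exists_evalFrom_letterA_letterD hn hpp hp hp'
  exact ⟨List.replicate k letterA ++ [letterD], by simp only [h, h', not_true]⟩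

end Component

section Product

variable {m n : ℕ} (hm : 3 ≤ m) (hn : 3 ≤ n)

/-- If `p ≠ p'`, some word keeps the images of `p` and `p'` in the first automaton distinct and
sends `q` to the final state in the second one. -/
theorem exists_evalFrom_ne_and_eq_lastState {p p' : Fin m} (hpp : p ≠ p') (q : Fin n) :
    ∃ w, (dfaAB m hm).evalFrom p w ≠ (dfaAB m hm).evalFrom p' w ∧
      (dfaAB n hn).evalFrom q (w.map swapAB) = lastState n hn := by
  by_cases hq : q = lastState n hn
  · exact ⟨[], hpp, hq⟩
  wlog hp : p ≠ lastState m hm generalizing p p'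
  · obtain ⟨w, h, h'⟩ := this hpp.symm fun h => hpp ((not_not.1 hp).trans h.symm)
    exact ⟨w, h.symm, h'⟩
  obtain ⟨k, hk⟩ := exists_evalFrom_letterA_eq hn hq (firstState_ne_lastState hn)
  obtain ⟨i, hi⟩ := exists_evalFrom_letterA_eq hn (firstState_ne_lastState hn)
    (penultState_ne_lastState hn)
  have hp1 := evalFrom_letterB_ne_lastState hm k hp
  have hpp1 := (evalFrom_letterB_injective hm k).ne hpp
  by_cases hp' : p' = lastState m hm
  · obtain ⟨j, hj⟩ := exists_evalFrom_letterA_eq hm hp1 (firstState_ne_lastState hm)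
    refine ⟨List.replicate k letterB ++ (List.replicate j letterA ++
      (List.replicate i letterB ++ [letterD])), ?_, ?_⟩
    · rw [hp', evalFrom_lastState, DFA.evalFrom_of_append, DFA.evalFrom_of_append, hj,
        evalFrom_letterB_letterD_firstState]
      exact firstState_ne_lastState hm
    · simp only [List.map_append, List.map_replicate, List.map_cons, List.map_nil,
        swapAB_letterA, swapAB_letterB, swapAB_letterD]
      rw [DFA.evalFrom_of_append, hk, DFA.evalFrom_of_append, evalFrom_letterB_firstState,
        DFA.evalFrom_append_singleton, hi, step_letterD_penultState]
  · refine ⟨List.replicate k letterB ++ (List.replicate i letterB ++ [letterD]), ?_, ?_⟩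
    · simp only [DFA.evalFrom_of_append, DFA.evalFrom_singleton]
      exact fun h => hpp1 (evalFrom_letterB_injective hm i (step_letterD_injOn hm
        (evalFrom_letterB_ne_lastState hm i hp1) (evalFrom_letterB_ne_lastState hm i
          (evalFrom_letterB_ne_lastState hm k hp')) h))
    · simp only [List.map_append, List.map_replicate, List.map_cons, List.map_nil,
        swapAB_letterB, swapAB_letterD]
      rw [DFA.evalFrom_of_append, hk, DFA.evalFrom_append_singleton, hi,
        step_letterD_penultState]

/-- If `p ≠ p'`, some word sends exactly one of `p` and `p'` to the final state of the first
automaton, and both `q` and `q'` to the final state of the second one. -/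
theorem exists_evalFrom_iff_not_and_eq_lastState {p p' : Fin m} (hpp : p ≠ p') (q q' : Fin n) :
    ∃ w, ((dfaAB m hm).evalFrom p w = lastState m hm ↔
        ¬ (dfaAB m hm).evalFrom p' w = lastState m hm) ∧
      (dfaAB n hn).evalFrom q (w.map swapAB) = lastState n hn ∧
      (dfaAB n hn).evalFrom q' (w.map swapAB) = lastState n hn := by
  obtain ⟨u, hu, hq⟩ := exists_evalFrom_ne_and_eq_lastState hm hn hpp q
  obtain ⟨v, hv, hq'⟩ := exists_evalFrom_ne_and_eq_lastState hm hn hu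
    ((dfaAB n hn).evalFrom q' (u.map swapAB))
  obtain ⟨w, hw⟩ := exists_evalFrom_eq_lastState_iff_not hm hv
  refine ⟨u ++ (v ++ w), ?_, ?_, ?_⟩
  · simpa only [DFA.evalFrom_of_append] using hw
  · simp only [List.map_append, DFA.evalFrom_of_append, hq, evalFrom_lastState]
  · simp only [List.map_append, DFA.evalFrom_of_append, hq', evalFrom_lastState]

/-- Some word sends `p'` to the final state of the first automaton, but neither `p` to this state
nor `q` to the final state of the second automaton. -/
theorem exists_evalFrom_eq_lastState_and_ne {p p' : Fin m} (hpp : p ≠ p')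
    (hp : p ≠ lastState m hm) (hp' : p' ≠ lastState m hm) {q : Fin n}
    (hq : q ≠ lastState n hn) :
    ∃ w, (dfaAB m hm).evalFrom p w ≠ lastState m hm ∧
      (dfaAB m hm).evalFrom p' w = lastState m hm ∧
      (dfaAB n hn).evalFrom q (w.map swapAB) ≠ lastState n hn := by
  obtain ⟨k, hk⟩ := exists_evalFrom_letterA_eq hn hq (firstState_ne_lastState hn)
  obtain ⟨j, hj, hj'⟩ := exists_evalFrom_letterA_letterD hm
    ((evalFrom_letterB_injective hm k).ne hpp) (evalFrom_letterB_ne_lastState hm k hp)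
    (evalFrom_letterB_ne_lastState hm k hp')
  refine ⟨List.replicate k letterB ++ (List.replicate j letterA ++ [letterD]), ?_, ?_, ?_⟩
  · rwa [DFA.evalFrom_of_append]
  · rwa [DFA.evalFrom_of_append]
  · simp only [List.map_append, List.map_replicate, List.map_cons, List.map_nil,
      swapAB_letterA, swapAB_letterB, swapAB_letterD]
    rw [DFA.evalFrom_of_append, hk, evalFrom_letterB_letterD_firstState]
    exact firstState_ne_lastState hn

/-- Two distinct pairs of states that are not final can be separated by the pairs with a final
component. -/
theorem exists_evalFrom_or_iff_not {p p' : Fin m} {q q' : Fin n} (h : p ≠ p' ∨ q ≠ q')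
    (hp : p ≠ lastState m hm) (hp' : p' ≠ lastState m hm)
    (hq : q ≠ lastState n hn) (hq' : q' ≠ lastState n hn) :
    ∃ w, ((dfaAB m hm).evalFrom p w = lastState m hm ∨
        (dfaAB n hn).evalFrom q (w.map swapAB) = lastState n hn) ↔
      ¬ ((dfaAB m hm).evalFrom p' w = lastState m hm ∨
        (dfaAB n hn).evalFrom q' (w.map swapAB) = lastState n hn) := by
  by_cases hqq : q = q'
  · subst hqq
    obtain ⟨w, h1, h2, h3⟩ := exists_evalFrom_eq_lastState_and_ne hm hn
      (h.resolve_right (not_not.2 rfl)) hp hp' hq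
    exact ⟨w, by simp [h1, h2, h3]⟩
  obtain ⟨k, hk⟩ := exists_evalFrom_letterA_eq hn hq (firstState_ne_lastState hn)
  obtain ⟨j, hj⟩ := exists_evalFrom_letterA_eq hm (evalFrom_letterB_ne_lastState hm k hp)
    (firstState_ne_lastState hm)
  have hne := (evalFrom_letterB_injective hn j).ne ((evalFrom_letterA_injective hn k).ne hqq)
  simp only [hk, evalFrom_letterB_firstState] at hne
  obtain ⟨i, hi, hi'⟩ := exists_evalFrom_letterA_letterD hn hne (firstState_ne_lastState hn)
    (evalFrom_letterB_ne_lastState hn j (evalFrom_letterA_ne_lastState hn k hq'))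
  refine ⟨List.replicate k letterB ++ (List.replicate j letterA ++
    (List.replicate i letterB ++ [letterD])), ?_⟩
  simp only [List.map_append, List.map_replicate, List.map_cons, List.map_nil,
    swapAB_letterA, swapAB_letterB, swapAB_letterD]
  have e : ∀ (l : ℕ) (hl : 3 ≤ l) (r : Fin l) (u v w : List alphabetABD),
      (dfaAB l hl).evalFrom r (u ++ (v ++ w)) =
        (dfaAB l hl).evalFrom ((dfaAB l hl).evalFrom ((dfaAB l hl).evalFrom r u) v) w := by
    intro l hl r u v w
    rw [DFA.evalFrom_of_append, DFA.evalFrom_of_append]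
  simp only [e, hj, hk, evalFrom_letterB_firstState, hi, hi',
    evalFrom_letterB_letterD_firstState, firstState_ne_lastState hm, or_true, or_self, not_true]

/-- The product of `D_m(a, b, -, d)` and `D_n(b, a, -, d)`, whose acceptance condition is the
Boolean combination `op` of those of the factors. -/
def boolDFA (op : Prop → Prop → Prop) : DFA alphabetABD (Fin m × Fin n) where
  step s x := ((dfaAB m hm).step s.1 x, (dfaBA n hn).step s.2 x)
  start := (firstState m hm, firstState n hn)
  accept := {s | op (s.1 = lastState m hm) (s.2 = lastState n hn)}

theorem evalFrom_boolDFA (op : Prop → Prop → Prop) (s : Fin m × Fin n)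
    (w : List alphabetABD) : (boolDFA hm hn op).evalFrom s w =
      ((dfaAB m hm).evalFrom s.1 w, (dfaAB n hn).evalFrom s.2 (w.map swapAB)) := by
  induction w generalizing s with
  | nil => rfl
  | cons x w ih => rw [DFA.evalFrom_cons, ih]; rfl

theorem mem_acceptsFrom_boolDFA (op : Prop → Prop → Prop) (s : Fin m × Fin n)
    (w : List alphabetABD) : w ∈ (boolDFA hm hn op).acceptsFrom s ↔
      op ((dfaAB m hm).evalFrom s.1 w = lastState m hm)
        ((dfaAB n hn).evalFrom s.2 (w.map swapAB) = lastState n hn) := by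
  rw [DFA.mem_acceptsFrom, evalFrom_boolDFA]
  rfl

theorem mem_accepts_boolDFA (op : Prop → Prop → Prop) (w : List alphabetABD) :
    w ∈ (boolDFA hm hn op).accepts ↔ op (w ∈ langAB m hm) (w ∈ langBA n hn) := by
  rw [mem_langAB_iff, mem_langBA_iff, dfaBA, DFA.mem_accepts (M := (dfaAB n hn).comap _),
    DFA.eval_comap]
  exact mem_acceptsFrom_boolDFA hm hn op _ w

/-- All states of the product automaton are reachable. -/
theorem boolDFA_eval_surjective (op : Prop → Prop → Prop) :
    Function.Surjective (boolDFA hm hn op).eval := by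
  have hf (p : Fin m) (q : Fin n) (hp : p ≠ lastState m hm) (hq : q ≠ lastState n hn) :
      ∃ w, (boolDFA hm hn op).eval w = (p, q) := by
    obtain ⟨k, hk⟩ := exists_evalFrom_letterA_eq hn (firstState_ne_lastState hn) hq
    obtain ⟨p', rfl⟩ := (Finite.injective_iff_surjective.1 (evalFrom_letterB_injective hm k)) p
    have hp' : p' ≠ lastState m hm := fun h => hp (by simp [h])
    obtain ⟨j, hj⟩ := exists_evalFrom_letterA_eq hm (firstState_ne_lastState hm) hp'
    refine ⟨List.replicate j letterA ++ List.replicate k letterB, ?_⟩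
    rw [DFA.eval, DFA.evalFrom_of_append, evalFrom_boolDFA, evalFrom_boolDFA]
    simp [boolDFA, hj, hk]
  have hstep {s t : Fin m × Fin n} (x : alphabetABD)
      (hs : ∃ w, (boolDFA hm hn op).eval w = s) (ht : (boolDFA hm hn op).step s x = t) :
      ∃ w, (boolDFA hm hn op).eval w = t := by
    obtain ⟨w, rfl⟩ := hs
    exact ⟨w ++ [x], by rw [DFA.eval_append_singleton, ht]⟩
  have hpm := penultState_ne_lastState hm
  have hpn := penultState_ne_lastState hn
  have hleft (q : Fin n) (hq : q ≠ lastState n hn) :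
      ∃ w, (boolDFA hm hn op).eval w = (lastState m hm, q) := by
    have h1 (q : Fin n) (hq : q ≠ lastState n hn) (hq' : q ≠ penultState n hn) :
        ∃ w, (boolDFA hm hn op).eval w = (lastState m hm, q) :=
      hstep letterD (hf _ _ hpm hq)
        (Prod.ext (step_letterD_penultState hm) (step_letterD_of_ne hn hq'))
    by_cases hq' : q = penultState n hn
    · obtain ⟨r, hr⟩ := (Finite.injective_iff_surjective.1 (step_letterA_injective hn)) q
      simp only at hr
      have hrl : r ≠ lastState n hn := by
        rintro rfl
        exact hq (hr.symm.trans (step_lastState hn _))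
      have hrp : r ≠ penultState n hn := by
        rintro rfl
        have := congrArg Fin.val (hr.trans hq')
        rw [val_step_letterA, val_penultState] at this
        split_ifs at this <;> omega
      exact hstep letterB (h1 r hrl hrp) (Prod.ext (step_lastState hm letterB) hr)
    · exact h1 q hq hq'
  have hright (p : Fin m) (hp : p ≠ lastState m hm) :
      ∃ w, (boolDFA hm hn op).eval w = (p, lastState n hn) := by
    have h1 (p : Fin m) (hp : p ≠ lastState m hm) (hp' : p ≠ penultState m hm) :
        ∃ w, (boolDFA hm hn op).eval w = (p, lastState n hn) :=
      hstep letterD (hf _ _ hp hpn)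
        (Prod.ext (step_letterD_of_ne hm hp') (step_letterD_penultState hn))
    by_cases hp' : p = penultState m hm
    · obtain ⟨r, hr⟩ := (Finite.injective_iff_surjective.1 (step_letterA_injective hm)) p
      simp only at hr
      have hrl : r ≠ lastState m hm := by
        rintro rfl
        exact hp (hr.symm.trans (step_lastState hm _))
      have hrp : r ≠ penultState m hm := by
        rintro rfl
        have := congrArg Fin.val (hr.trans hp')
        rw [val_step_letterA, val_penultState] at this
        split_ifs at this <;> omega
      exact hstep letterA (h1 r hrl hrp) (Prod.ext hr (step_lastState hn letterB))
    · exact h1 p hp hp'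
  rintro ⟨p, q⟩
  by_cases hp : p = lastState m hm <;> by_cases hq : q = lastState n hn
  · subst hp hq
    exact hstep letterD (hleft _ hpn)
      (Prod.ext (step_lastState hm letterD) (step_letterD_penultState hn))
  · exact hp ▸ hleft q hq
  · exact hq ▸ hright p hp
  · exact hf p q hp hq

end Product

/-- The complexity of the language of an accessible DFA in which the states of `K` are pairwise
equivalent and no other two distinct states are. -/
theorem quotientComplexity_accepts {α σ : Type*} [Fintype σ] [DecidableEq σ] (M : DFA α σ)
    (hM : Function.Surjective M.eval) (K : Finset σ) (hK : K.Nonempty)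
    (hKK : ∀ s ∈ K, ∀ t ∈ K, M.acceptsFrom s = M.acceptsFrom t)
    (hsep : ∀ s t, s ≠ t → ¬ (s ∈ K ∧ t ∈ K) →
      ∃ w, w ∈ M.acceptsFrom s ↔ ¬ w ∈ M.acceptsFrom t) :
    quotientComplexity M.accepts = ((Fintype.card σ - (K.card - 1) : ℕ) : ℕ∞) := by
  obtain ⟨k, hk⟩ := hK
  have hrange : Set.range M.accepts.leftQuotient =
      M.acceptsFrom '' (insert k Kᶜ : Finset σ) := by
    rw [Language.leftQuotient_accepts, hM.range_comp]
    refine subset_antisymm ?_ (Set.image_subset_range _ _)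
    rintro _ ⟨s, rfl⟩
    by_cases hs : s ∈ K
    · exact ⟨k, by simp, hKK k hk s hs⟩
    · exact ⟨s, by simp [hs], rfl⟩
  have hinj : Set.InjOn M.acceptsFrom (insert k Kᶜ : Finset σ) := by
    intro s hs t ht hst
    by_contra hne
    simp only [Finset.coe_insert, Finset.coe_compl, Set.mem_insert_iff, Set.mem_compl_iff,
      Finset.mem_coe] at hs ht
    obtain ⟨w, hw⟩ := hsep s t hne (by
      rintro ⟨hs', ht'⟩
      exact hne ((hs.resolve_right (not_not.2 hs')).trans
        (ht.resolve_right (not_not.2 ht')).symm))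
    rw [hst] at hw
    exact (iff_not_self hw).elim
  rw [quotientComplexity, hrange, hinj.encard_image, Set.encard_coe_eq_coe_finsetCard,
    Finset.card_insert_of_notMem (by simpa using hk), Finset.card_compl]
  have h1 := K.card_le_univ
  have h2 : 0 < K.card := Finset.card_pos.2 ⟨k, hk⟩
  congr 1
  omega

theorem quotientComplexity_eq_of_boolDFA {m n : ℕ} (hm : 3 ≤ m) (hn : 3 ≤ n)
    (op : Prop → Prop → Prop) (L : Language alphabetABD)
    (hL : ∀ w, w ∈ L ↔ op (w ∈ langAB m hm) (w ∈ langBA n hn))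
    (K : Finset (Fin m × Fin n)) (hK : K.Nonempty)
    (hKK : ∀ s ∈ K, ∀ t ∈ K, ∀ w, w ∈ (boolDFA hm hn op).acceptsFrom s →
      w ∈ (boolDFA hm hn op).acceptsFrom t)
    (hsep : ∀ s t, s ≠ t → ¬ (s ∈ K ∧ t ∈ K) →
      ∃ w, w ∈ (boolDFA hm hn op).acceptsFrom s ↔ ¬ w ∈ (boolDFA hm hn op).acceptsFrom t) :
    quotientComplexity L = ((m * n - (K.card - 1) : ℕ) : ℕ∞) := by
  have h : L = (boolDFA hm hn op).accepts := by
    ext w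
    rw [hL, mem_accepts_boolDFA]
  rw [h, quotientComplexity_accepts _ (boolDFA_eval_surjective hm hn op) K hK
    (fun s hs t ht => by
      ext w
      exact ⟨hKK s hs t ht w, hKK t ht s hs w⟩) hsep]
  simp

theorem mainTheorem7 (m n : ℕ) (hm : 3 ≤ m) (hn : 3 ≤ n) :
    quotientComplexity (langAB m hm ⊓ langBA n hn) = ((m * n : ℕ) : ℕ∞) ∧
    quotientComplexity (symmDiff (langAB m hm) (langBA n hn)) = ((m * n : ℕ) : ℕ∞) ∧
    quotientComplexity (langAB m hm \ langBA n hn) = ((m * n - (m - 1) : ℕ) : ℕ∞) ∧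
    quotientComplexity (langAB m hm ⊔ langBA n hn) = ((m * n - (m + n - 2) : ℕ) : ℕ∞) := by
  have hleft (s t : Fin m × Fin n) (h : s.1 ≠ t.1) :=
    exists_evalFrom_iff_not_and_eq_lastState hm hn h s.2 t.2
  have hright (s t : Fin m × Fin n) (h : s.2 ≠ t.2) :
      ∃ w, ((dfaAB n hn).evalFrom s.2 (w.map swapAB) = lastState n hn ↔
          ¬ (dfaAB n hn).evalFrom t.2 (w.map swapAB) = lastState n hn) ∧
        (dfaAB m hm).evalFrom s.1 w = lastState m hm ∧
        (dfaAB m hm).evalFrom t.1 w = lastState m hm := by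
    obtain ⟨w, hw⟩ := exists_evalFrom_iff_not_and_eq_lastState hn hm h s.1 t.1
    exact ⟨w.map swapAB, by simpa only [map_swapAB_map_swapAB] using hw⟩
  have hne (s t : Fin m × Fin n) (h : s ≠ t) : s.1 ≠ t.1 ∨ s.2 ≠ t.2 := by
    by_contra! h'
    exact h (Prod.ext h'.1 h'.2)
  refine ⟨?_, ?_, ?_, ?_⟩
  · refine (quotientComplexity_eq_of_boolDFA hm hn And _ (fun w => Iff.rfl)
      {(lastState m hm, lastState n hn)} (by simp) (by simp) fun s t hst _ => ?_).trans (by simp)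
    simp only [mem_acceptsFrom_boolDFA]
    rcases hne s t hst with h | h
    · obtain ⟨w, h1, h2, h3⟩ := hleft s t h
      exact ⟨w, by simpa only [h2, h3, and_true] using h1⟩
    · obtain ⟨w, h1, h2, h3⟩ := hright s t h
      exact ⟨w, by simpa only [h2, h3, true_and] using h1⟩
  · refine (quotientComplexity_eq_of_boolDFA hm hn (fun x y => (x ∧ ¬ y) ∨ (y ∧ ¬ x)) _
      (fun w => Iff.rfl) {(lastState m hm, lastState n hn)} (by simp) (by simp)
      fun s t hst _ => ?_).trans (by simp)
    simp only [mem_acceptsFrom_boolDFA]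
    rcases hne s t hst with h | h
    · obtain ⟨w, h1, h2, h3⟩ := hleft s t h
      exact ⟨w, by simp only [h2, h3]; tauto⟩
    · obtain ⟨w, h1, h2, h3⟩ := hright s t h
      exact ⟨w, by simp only [h2, h3]; tauto⟩
  · refine (quotientComplexity_eq_of_boolDFA hm hn (fun x y => x ∧ ¬ y) _
      (fun w => Iff.rfl) (Finset.univ ×ˢ {lastState n hn})
      ⟨(lastState m hm, lastState n hn), by simp⟩ ?_ fun s t hst hK => ?_).trans (by simp)
    · rintro ⟨p, q⟩ hs ⟨p', q'⟩ ht w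
      simp only [Finset.mem_product, Finset.mem_univ, true_and, Finset.mem_singleton] at hs ht
      simp [mem_acceptsFrom_boolDFA, hs]
    simp only [Finset.mem_product, Finset.mem_univ, true_and, Finset.mem_singleton] at hK
    simp only [mem_acceptsFrom_boolDFA]
    by_cases h : s.2 = t.2
    · have ht : t.2 ≠ lastState n hn := fun h' => hK ⟨h.trans h', h'⟩
      have hst := (hne s t hst).resolve_right (not_not.2 h)
      rw [h]
      by_cases hs1 : s.1 = lastState m hm
      · exact ⟨[], by simpa [ht, hs1] using fun h => hst (hs1.trans h.symm)⟩
      by_cases ht1 : t.1 = lastState m hm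
      · exact ⟨[], by simpa [ht, ht1] using hs1⟩
      obtain ⟨w, h1, h2, h3⟩ := exists_evalFrom_eq_lastState_and_ne hm hn hst hs1 ht1 ht
      exact ⟨w, by simp only [h1, h2, h3]; tauto⟩
    · obtain ⟨w, h1, h2, h3⟩ := hright s t h
      exact ⟨w, by simp only [h2, h3]; tauto⟩
  · have hcard : (({lastState m hm}ᶜ ×ˢ {lastState n hn}ᶜ : Finset (Fin m × Fin n))ᶜ).card - 1 =
        m + n - 2 := by
      rw [Finset.card_compl, Finset.card_product, Finset.card_compl, Finset.card_compl]
      obtain ⟨m, rfl⟩ := Nat.exists_eq_add_of_le' hm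
      obtain ⟨n, rfl⟩ := Nat.exists_eq_add_of_le' hn
      simp only [Fintype.card_prod, Fintype.card_fin, Finset.card_singleton]
      have : (m + 3) * (n + 3) = (m + 3 - 1) * (n + 3 - 1) + (m + n + 5) := by
        simp only [Nat.add_one_sub_one]
        ring
      omega
    refine (quotientComplexity_eq_of_boolDFA hm hn Or _
      (fun w => Iff.rfl) ({lastState m hm}ᶜ ×ˢ {lastState n hn}ᶜ)ᶜ
      ⟨(lastState m hm, lastState n hn), by simp⟩ ?_ fun s t hst hK => ?_).trans
      (by rw [hcard])
    · rintro ⟨p, q⟩ hs ⟨p', q'⟩ ht w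
      simp only [Finset.mem_compl, Finset.mem_product, Finset.mem_singleton, not_and_or,
        not_not] at hs ht
      rcases ht with rfl | rfl <;> simp [mem_acceptsFrom_boolDFA]
    simp only [Finset.mem_compl, Finset.mem_product, Finset.mem_singleton, not_and_or,
      not_not] at hK
    simp only [mem_acceptsFrom_boolDFA]
    by_cases hs : s.1 = lastState m hm ∨ s.2 = lastState n hn
    · exact ⟨[], iff_of_true hs fun h => by tauto⟩
    by_cases ht : t.1 = lastState m hm ∨ t.2 = lastState n hn
    · exact ⟨[], iff_of_false hs (not_not.2 ht)⟩
    rw [not_or] at hs ht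
    exact exists_evalFrom_or_iff_not hm hn (hne s t hst) hs.1 ht.1 hs.2 ht.2
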